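/- Let $K$ be a field. By a $K$-variety we mean a geometrically reduced, separated scheme of finite type over $K$. Let $K_0(\mathrm{Var}_K)$ be the Grothendieck ring of $K$-varieties: the free abelian group generated by the isomorphism classes $[V]$ of $K$-varieties $V$, modulo the scissors relations $[V] = [W] + [V\setminus W]$ whenever $W$ is a closed $K$-subvariety of $V$, with the multiplication determined by $[V]\cdot[W] = [V\times_{\operatorname{Spec} K} W]$. **Theorem.** Let $\mu\colon K_0(\mathrm{Var}_K)\to\mathbb{R}$ be a (unital) ring homomorphism such that $\mu([V])\ge 0$ for every $K$-variety $V$. Then there is a finite field $L$ containing $K$ such that, for every $K$-variety $V$, the set $V(L)$ of $L$-valued points of $V$ over $K$ is finite and $\mu([V]) = |V(L)|$. In words: every positive motivic measure is a counting measure. -/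

import Mathlib

open CategoryTheory AlgebraicGeometry MonoidalCategory

universe u

noncomputable section

namespace MotivicMeasure

/-- A `K`-scheme is a `K`-variety if it is geometrically reduced, separated and of finite type
(that is, locally of finite type and quasi-compact) over `K`. -/
structure IsKVariety (K : Type u) [Field K] (X : Over (Spec (.of K))) : Prop where
  geometricallyReduced : GeometricallyReduced X.hom
  isSeparated : IsSeparated X.hom
  locallyOfFiniteType : LocallyOfFiniteType X.hom
  quasiCompact : QuasiCompact X.hom

/-- The property of being a `K`-variety, as a property of objects of the category of
`K`-schemes. -/
def isKVariety (K : Type u) [Field K] : ObjectProperty (Over (Spec (.of K))) :=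
  fun X => IsKVariety K X

/-- The category of `K`-varieties: the full subcategory of the category of `K`-schemes. -/
abbrev KVariety (K : Type u) [Field K] : Type (u + 1) :=
  (isKVariety K).FullSubcategory

section Product

variable {K : Type u} [Field K]

/-- `Spec K` is a `K`-variety. -/
theorem isKVariety_unit : IsKVariety K (𝟙_ (Over (Spec (.of K)))) where
  geometricallyReduced := by
    refine ⟨fun L _ y Z fst snd h => ?_⟩
    have : IsIso snd := MorphismProperty.of_isPullback (P := .isomorphisms Scheme) h
      (inferInstanceAs (IsIso (𝟙 (Spec (.of K)))))
    exact isReduced_of_isOpenImmersion snd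
  isSeparated := inferInstanceAs (IsSeparated (𝟙 (Spec (.of K))))
  locallyOfFiniteType := inferInstanceAs (LocallyOfFiniteType (𝟙 (Spec (.of K))))
  quasiCompact := inferInstanceAs (QuasiCompact (𝟙 (Spec (.of K))))

/-- The fiber product over `Spec K` of two `K`-varieties is a `K`-variety. -/
theorem isKVariety_tensor {X Y : Over (Spec (.of K))} (hX : IsKVariety K X)
    (hY : IsKVariety K Y) : IsKVariety K (X ⊗ Y) := by
  obtain ⟨hX₁, hX₂, hX₃, hX₄⟩ := hX
  obtain ⟨hY₁, hY₂, hY₃, hY₄⟩ := hY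
  refine ⟨⟨fun L _ y Z fst snd h => ?_⟩, ?_, ?_, ?_⟩
  · have hflat : Flat X.hom := inferInstance
    let p : Z ⟶ Limits.pullback Y.hom y := Limits.pullback.lift
      (fst ≫ Limits.pullback.snd X.hom Y.hom) snd (by
        rw [Category.assoc, ← Limits.pullback.condition]
        exact h.w)
    have : IsReduced (Limits.pullback Y.hom y) :=
      hY₁.geometrically_isReduced _ _ _ (.of_hasPullback _ _)
    have : IsLocallyNoetherian (Limits.pullback Y.hom y) :=
      LocallyOfFiniteType.isLocallyNoetherian (Limits.pullback.snd Y.hom y)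
    have hp : IsPullback p fst (Limits.pullback.fst Y.hom y)
        (Limits.pullback.snd X.hom Y.hom) := by
      refine IsPullback.of_right (h₁₂ := Limits.pullback.snd Y.hom y) (h₂₂ := Y.hom)
        (v₁₃ := y) ?_ (Limits.pullback.lift_fst _ _ _)
        (IsPullback.of_hasPullback Y.hom y).flip
      have := h.flip
      simp only [Over.tensorObj_hom, Limits.pullback.condition] at this
      rwa [Limits.pullback.lift_snd]
    have hq : IsPullback (fst ≫ Limits.pullback.fst X.hom Y.hom) p X.hom
        (Limits.pullback.fst Y.hom y ≫ Y.hom) :=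
      (hp.paste_vert (IsPullback.of_hasPullback X.hom Y.hom).flip).flip
    exact isReduced_of_isOpenImmersion hq.isoPullback.hom
  · exact inferInstanceAs (IsSeparated (Limits.pullback.fst X.hom Y.hom ≫ X.hom))
  · exact inferInstanceAs (LocallyOfFiniteType (Limits.pullback.fst X.hom Y.hom ≫ X.hom))
  · exact inferInstanceAs (QuasiCompact (Limits.pullback.fst X.hom Y.hom ≫ X.hom))

instance : (isKVariety K).IsMonoidal where
  prop_unit := isKVariety_unit
  prop_tensor _ _ hX hY := isKVariety_tensor hX hY

end Product

/-- The set of isomorphism classes of `K`-varieties. It is a commutative monoid under the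
fiber product over `Spec K`. -/
abbrev IsoClass (K : Type u) [Field K] : Type (u + 1) := Skeleton (KVariety K)

/-- The scissors relations `[V] - ([W] + [V ∖ W])` in the free abelian group on the isomorphism
classes of `K`-varieties, where `i : W ⟶ V` runs through the closed immersions of `K`-varieties
and `V ∖ W` is given as an open immersion `j : U ⟶ V` onto the complement of the image of `i`. -/
def scissors (K : Type u) [Field K] : Set (FreeAbelianGroup (IsoClass K)) :=
  {x | ∃ (V W U : KVariety K) (i : W ⟶ V) (j : U ⟶ V),
    IsClosedImmersion i.hom.left ∧ IsOpenImmersion j.hom.left ∧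
    Set.range j.hom.left = (Set.range i.hom.left)ᶜ ∧
    x = .of (toSkeleton V) - (.of (toSkeleton W) + .of (toSkeleton U))}

section

variable {K : Type u} [Field K]

theorem isPullback_whiskerLeft (Z : Over (Spec (.of K))) {X Y : Over (Spec (.of K))}
    (f : X ⟶ Y) :
    IsPullback (Z ◁ f).left (Limits.pullback.snd Z.hom X.hom)
      (Limits.pullback.snd Z.hom Y.hom) f.left := by
  have hfst : (Z ◁ f).left ≫ Limits.pullback.fst Z.hom Y.hom =
      Limits.pullback.fst Z.hom X.hom :=
    Over.whiskerLeft_left_fst f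
  have hsnd : (Z ◁ f).left ≫ Limits.pullback.snd Z.hom Y.hom =
      Limits.pullback.snd Z.hom X.hom ≫ f.left :=
    Over.whiskerLeft_left_snd f
  refine IsPullback.flip (IsPullback.of_bot (v₂₁ := Limits.pullback.fst Z.hom Y.hom)
    (v₂₂ := Y.hom) (h₃₁ := Z.hom) ?_ hsnd.symm (IsPullback.of_hasPullback Z.hom Y.hom).flip)
  rw [hfst, Over.w f]
  exact (IsPullback.of_hasPullback Z.hom X.hom).flip

theorem range_of_isPullback {P X Y S : Scheme.{u}} {fst : P ⟶ X} {snd : P ⟶ Y} {f : X ⟶ S}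
    {g : Y ⟶ S} (h : IsPullback fst snd f g) : Set.range fst = f ⁻¹' Set.range g := by
  rw [← Scheme.Pullback.range_fst, ← h.isoPullback_inv_fst, Scheme.Hom.comp_base,
    TopCat.coe_comp, Function.Surjective.range_comp h.isoPullback.inv.surjective]

/-- The scissors relations are stable under multiplication by the class of a `K`-variety. -/
theorem of_mul_mem_scissors (Z : KVariety K) {x : FreeAbelianGroup (IsoClass K)}
    (hx : x ∈ scissors K) : .of (toSkeleton Z) * x ∈ scissors K := by
  obtain ⟨V, W, U, i, j, hi, hj, hr, rfl⟩ := hx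
  have pi := isPullback_whiskerLeft Z.obj i.hom
  have pj := isPullback_whiskerLeft Z.obj j.hom
  refine ⟨Z ⊗ V, Z ⊗ W, Z ⊗ U, Z ◁ i, Z ◁ j,
    MorphismProperty.of_isPullback (P := @IsClosedImmersion) pi.flip hi,
    MorphismProperty.of_isPullback (P := @IsOpenImmersion) pj.flip hj, ?_, ?_⟩
  · have ri := range_of_isPullback pi
    have rj := range_of_isPullback pj
    refine rj.trans ?_
    rw [hr, Set.preimage_compl]
    exact congrArg _ ri.symm
  · rw [mul_sub, mul_add, FreeAbelianGroup.of_mul_of, FreeAbelianGroup.of_mul_of,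
      FreeAbelianGroup.of_mul_of, Skeleton.toSkeleton_tensorObj, Skeleton.toSkeleton_tensorObj,
      Skeleton.toSkeleton_tensorObj]

end

/-- The subgroup generated by the scissors relations, which is an ideal. -/
def scissorsIdeal (K : Type u) [Field K] : Ideal (FreeAbelianGroup (IsoClass K)) where
  __ := (AddSubgroup.closure (scissors K)).toAddSubmonoid
  smul_mem' := by
    intro a x hx
    change x ∈ AddSubgroup.closure (scissors K) at hx
    change a * x ∈ AddSubgroup.closure (scissors K)
    induction a using FreeAbelianGroup.induction_on with
    | zero => rw [zero_mul]; exact zero_mem _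
    | of c =>
      induction c using Quotient.inductionOn with | _ Z =>
      induction hx using AddSubgroup.closure_induction with
      | mem x hx => exact AddSubgroup.subset_closure (of_mul_mem_scissors Z hx)
      | zero => rw [mul_zero]; exact zero_mem _
      | add x y _ _ hx hy => rw [mul_add]; exact add_mem hx hy
      | neg x _ hx => rw [mul_neg]; exact neg_mem hx
    | neg c h => rw [neg_mul]; exact neg_mem h
    | add a b ha hb => rw [add_mul]; exact add_mem ha hb

/-- The Grothendieck ring of `K`-varieties: the free abelian group on the isomorphism classes of
`K`-varieties modulo the scissors relations, with the multiplication induced by the fiber product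
over `Spec K`. -/
def K0Var (K : Type u) [Field K] : Type (u + 1) :=
  FreeAbelianGroup (IsoClass K) ⧸ scissorsIdeal K

instance (K : Type u) [Field K] : CommRing (K0Var K) :=
  inferInstanceAs (CommRing (FreeAbelianGroup (IsoClass K) ⧸ scissorsIdeal K))

/-- The class `[V]` of a `K`-variety `V` in `K0Var K`. -/
def K0Var.mk {K : Type u} [Field K] (V : KVariety K) : K0Var K :=
  Ideal.Quotient.mk (scissorsIdeal K) (.of (toSkeleton V))

/-- The set `V(L)` of `L`-valued points of the `K`-variety `V`, for a field extension `L` of `K`: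
the morphisms of `K`-schemes from `Spec L` to `V`. -/
abbrev Points {K : Type u} [Field K] (V : KVariety K) (L : Type u) [Field L] [Algebra K L] :
    Type u :=
  Over.mk (Spec.map (CommRingCat.ofHom (algebraMap K L))) ⟶ V.obj

end MotivicMeasure

end

noncomputable section

namespace MotivicMeasure

open TensorProduct

section

/-! ### Reducedness over finite fields, and varieties -/

/-! Positivity makes `μ` monotone for closed immersions, and this bounds everything by the value `q`
of the affine line. If `K` were infinite, the line would contain arbitrarily many rational points,
so `K` is finite (`finite_field`). Among finite extensions with nonzero measure there is one of
maximal degree, `L`; splitting `L ⊗ M` into fields shows that every finite `M` has measure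
`#Hom_K(M, L)` (`exists_field`).

It remains to see that a positive measure is determined by its values on finite extensions of `K`
(`eq_of_forall_field`), since counting `L`-points is another such measure with the same values. By
noetherian induction this reduces to an affine domain `A`. If `A` is infinite, take `N > q` elements
of it and invert their differences: over the resulting open set `D` the line has `N` disjoint
sections, so `N * φ(D) ≤ q * φ(D)` and `φ(D) = 0`. Hence `A` has the measure of a proper closed
subset. A finite domain is a finite extension of `K`. -/

theorem isReduced_tensorProduct_of_finite (K A F : Type*) [Field K] [Finite K] [CommRing A]
    [Algebra K A] [IsReduced A] [CommRing F] [Algebra K F] [IsReduced F] :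
    IsReduced (A ⊗[K] F) := by
  obtain ⟨p, hp⟩ := CharP.exists K
  have : Fact p.Prime := ⟨(CharP.char_is_prime_or_zero K p).resolve_right
    (CharP.char_ne_zero_of_finite K p)⟩
  rcases subsingleton_or_nontrivial (A ⊗[K] F) with h | h
  · infer_instance
  have : CharP (A ⊗[K] F) p := charP_of_injective_algebraMap (algebraMap K _).injective p
  have : Nontrivial F := by
    by_contra hF
    rw [not_nontrivial_iff_subsingleton] at hF
    exact not_subsingleton (A ⊗[K] F) inferInstance
  have : CharP F p := charP_of_injective_algebraMap (algebraMap K _).injective p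
  rw [isReduced_iff_pow_one_lt p (Fact.out : p.Prime).one_lt]
  intro x hx
  -- With `x = ∑ aᵢ ⊗ bᵢ` one has `x ^ p = ∑ aᵢ ^ p ⊗ bᵢ ^ p`. The `bᵢ ^ p` remain independent
  -- because `K` is perfect: a relation among them is the `p`-th power of one among the `bᵢ`.
  let b := Module.Free.chooseBasis K F
  obtain ⟨a, rfl⟩ := TensorProduct.eq_repr_basis_right b x
  have hb : LinearIndependent K (fun i => b i ^ p) := by
    rw [linearIndependent_iff']
    intro s g hg i hi
    have h1 : (∑ i ∈ s, (frobeniusEquiv K p).symm (g i) • b i) ^ p = 0 := by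
      rw [← hg, sum_pow_char]
      refine Finset.sum_congr rfl fun i _ => ?_
      rw [smul_pow, frobeniusEquiv_symm_pow_p]
    have h2 := linearIndependent_iff'.1 b.linearIndependent s _
      (pow_eq_zero_iff (Fact.out : p.Prime).ne_zero |>.1 h1) i hi
    simpa using h2
  rw [Finsupp.sum, sum_pow_char] at hx
  have h3 := linearIndependent_iff'.1 (Module.Flat.linearIndependent_one_tmul (S := A) hb)
    a.support (fun i => a i ^ p) (by
      rw [← hx]
      refine Finset.sum_congr rfl fun i _ => ?_
      rw [TensorProduct.smul_tmul', smul_eq_mul, mul_one, Algebra.TensorProduct.tmul_pow])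
  refine Finset.sum_eq_zero fun i hi => ?_
  dsimp only
  rw [pow_eq_zero_iff (Fact.out : p.Prime).ne_zero |>.1 (h3 i hi), TensorProduct.zero_tmul]

variable {K : Type u} [Field K]

theorem geometricallyReduced_specMap_of_forall (A : Type u) [CommRing A] [Algebra K A]
    (H : ∀ (F : Type u) [Field F] [Algebra K F], IsReduced (A ⊗[K] F)) :
    GeometricallyReduced (Spec.map (CommRingCat.ofHom (algebraMap K A))) := by
  refine ⟨fun F _ y Z fst snd h => ?_⟩
  obtain ⟨ψ, rfl⟩ := Spec.map_surjective y
  let _ : Algebra K F := ψ.hom.toAlgebra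
  have := H F
  have e : Z ≅ Spec (.of (A ⊗[K] F)) := h.isoPullback ≪≫ pullbackSpecIso K A F
  exact isReduced_of_isOpenImmersion e.hom

theorem geometricallyReduced_of_openCover {X Y : Scheme.{u}} (f : X ⟶ Y) (𝒰 : X.OpenCover)
    (H : ∀ i, GeometricallyReduced (𝒰.f i ≫ f)) : GeometricallyReduced f := by
  refine ⟨fun F _ y Z fst snd h => ?_⟩
  have hred : ∀ i, AlgebraicGeometry.IsReduced ((𝒰.pullback₁ fst).X i) := fun i =>
    (H i).geometrically_isReduced y _ _
      ((IsPullback.of_hasPullback fst (𝒰.f i)).flip.paste_vert h)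
  exact IsReduced.of_openCover _ (𝒰.pullback₁ fst)

theorem geometricallyReduced_specMap [Finite K] {A : CommRingCat.{u}} [IsReduced A]
    (φ : .of K ⟶ A) : GeometricallyReduced (Spec.map φ) := by
  let _ : Algebra K A := φ.hom.toAlgebra
  exact geometricallyReduced_specMap_of_forall A
    fun F _ _ => isReduced_tensorProduct_of_finite K A F

theorem geometricallyReduced_of_finite [Finite K] {X : Scheme.{u}} [AlgebraicGeometry.IsReduced X]
    (f : X ⟶ Spec (.of K)) : GeometricallyReduced f := by
  refine geometricallyReduced_of_openCover f X.affineCover fun i => ?_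
  obtain ⟨φ, hφ⟩ := Spec.map_surjective (X.affineCover.f i ≫ f)
  have hred : AlgebraicGeometry.IsReduced (X.affineCover.X i) := inferInstance
  have := (affine_isReduced_iff _).1 hred
  exact hφ ▸ geometricallyReduced_specMap φ

/-- The spectrum of a `K`-algebra, as a scheme over `K`. -/
def specOver (K : Type u) [Field K] (A : Type u) [CommRing A] [Algebra K A] :
    Over (Spec (.of K)) :=
  Over.mk (Spec.map (CommRingCat.ofHom (algebraMap K A)))

/-- The morphism of spectra over `K` given by a homomorphism of `K`-algebras. -/
def specOverMap {A B : Type u} [CommRing A] [Algebra K A] [CommRing B] [Algebra K B]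
    (f : A →ₐ[K] B) : specOver K B ⟶ specOver K A :=
  Over.homMk (Spec.map (CommRingCat.ofHom f.toRingHom)) (by
    dsimp [specOver]
    rw [← Spec.map_comp, ← CommRingCat.ofHom_comp]
    congr 2
    exact f.comp_algebraMap)

theorem IsKVariety.of_isOpenImmersion {X U : Over (Spec (.of K))} (hX : IsKVariety K X)
    (j : U ⟶ X) [IsOpenImmersion j.left] : IsKVariety K U := by
  obtain ⟨h1, h2, h3, h4⟩ := hX
  -- Noetherianity makes the open immersion quasi-compact.
  have : IsLocallyNoetherian X.left := LocallyOfFiniteType.isLocallyNoetherian X.hom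
  have : CompactSpace X.left := QuasiCompact.compactSpace_of_compactSpace X.hom
  have : IsNoetherian X.left := ⟨⟩
  refine ⟨⟨fun L _ y Z fst snd h => ?_⟩, ?_, ?_, ?_⟩
  · have : AlgebraicGeometry.IsReduced (Limits.pullback X.hom y) :=
      h1.geometrically_isReduced _ _ _ (.of_hasPullback _ _)
    have h' : IsPullback fst snd (j.left ≫ X.hom) y := by rwa [Over.w j]
    let p : Z ⟶ Limits.pullback X.hom y := Limits.pullback.lift (fst ≫ j.left) snd
      (by rw [Category.assoc, h'.w])
    have hp : IsPullback p fst (Limits.pullback.fst X.hom y) j.left := by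
      refine IsPullback.of_right (h₁₂ := Limits.pullback.snd X.hom y) (h₂₂ := X.hom)
        (v₁₃ := y) ?_ (Limits.pullback.lift_fst _ _ _) (IsPullback.of_hasPullback X.hom y).flip
      rw [Limits.pullback.lift_snd]
      exact h'.flip
    have : IsOpenImmersion p :=
      MorphismProperty.of_isPullback (P := @IsOpenImmersion) hp.flip ‹_›
    exact isReduced_of_isOpenImmersion p
  · rw [← Over.w j]; infer_instance
  · rw [← Over.w j]; infer_instance
  · rw [← Over.w j]; infer_instance

/-- Over an imperfect field, reducedness of `W` would not give geometric reducedness; this is why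
the finiteness of `K` has to be established before any stratification. -/
theorem IsKVariety.of_isClosedImmersion [Finite K] {X W : Over (Spec (.of K))}
    (hX : IsKVariety K X) (i : W ⟶ X) [IsClosedImmersion i.left]
    [AlgebraicGeometry.IsReduced W.left] : IsKVariety K W := by
  obtain ⟨h1, h2, h3, h4⟩ := hX
  refine ⟨geometricallyReduced_of_finite _, ?_, ?_, ?_⟩ <;>
  · rw [← Over.w i]; infer_instance

theorem IsKVariety.of_iso {X Y : Over (Spec (.of K))} (hX : IsKVariety K X) (e : Y ≅ X) :
    IsKVariety K Y :=
  have : IsIso e.hom.left := inferInstanceAs (IsIso ((Over.forget _).map e.hom))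
  hX.of_isOpenImmersion e.hom

theorem isKVariety_specOver_of_forall (A : Type u) [CommRing A] [Algebra K A]
    [Algebra.FiniteType K A] (H : ∀ (F : Type u) [Field F] [Algebra K F], IsReduced (A ⊗[K] F)) :
    IsKVariety K (specOver K A) := by
  refine ⟨geometricallyReduced_specMap_of_forall A H, ?_, ?_, ?_⟩
  · dsimp [specOver]; infer_instance
  · dsimp [specOver]
    rw [HasRingHomProperty.Spec_iff (P := @LocallyOfFiniteType)]
    exact RingHom.finiteType_algebraMap.2 ‹_›
  · dsimp [specOver]; infer_instance

end

section

/-! ### Positive measures -/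

/-- A real-valued function on `K`-schemes is a positive measure if, on `K`-varieties, it is
nonnegative, invariant under isomorphisms, additive with respect to scissors relations, and
multiplicative with respect to products. -/
structure IsPositiveMeasure {K : Type u} [Field K] (φ : Over (Spec (.of K)) → ℝ) : Prop where
  nonneg : ∀ {X}, IsKVariety K X → 0 ≤ φ X
  iso : ∀ {X Y}, IsKVariety K X → (X ≅ Y) → φ X = φ Y
  scissors : ∀ {V W U : Over (Spec (.of K))} (i : W ⟶ V) (j : U ⟶ V), IsKVariety K V →
    IsKVariety K W → IsClosedImmersion i.left → IsOpenImmersion j.left →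
    Set.range j.left = (Set.range i.left)ᶜ → φ V = φ W + φ U
  unit : φ (𝟙_ _) = 1
  tensor : ∀ {X Y}, IsKVariety K X → IsKVariety K Y → φ (X ⊗ Y) = φ X * φ Y

variable {K : Type u} [Field K]

/-! ### From ring homomorphisms on the Grothendieck ring to positive measures. -/

theorem K0Var.mk_eq_of_iso {V W : KVariety K} (e : V ≅ W) : K0Var.mk V = K0Var.mk W := by
  rw [K0Var.mk, K0Var.mk, toSkeleton_eq_toSkeleton_iff.2 ⟨e⟩]

theorem K0Var.mk_tensor (V W : KVariety K) : K0Var.mk (V ⊗ W) = K0Var.mk V * K0Var.mk W := by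
  rw [K0Var.mk, Skeleton.toSkeleton_tensorObj, ← FreeAbelianGroup.of_mul_of]
  exact map_mul (Ideal.Quotient.mk (scissorsIdeal K)) _ _

theorem K0Var.mk_unit : K0Var.mk (𝟙_ (KVariety K)) = 1 := by
  exact map_one (Ideal.Quotient.mk (scissorsIdeal K))

theorem K0Var.mk_eq_add {V W U : KVariety K} (i : W ⟶ V) (j : U ⟶ V)
    (hi : IsClosedImmersion i.hom.left) (hj : IsOpenImmersion j.hom.left)
    (h : Set.range j.hom.left = (Set.range i.hom.left)ᶜ) :
    K0Var.mk V = K0Var.mk W + K0Var.mk U := by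
  refine (Ideal.Quotient.eq.2 ?_).trans (map_add (Ideal.Quotient.mk (scissorsIdeal K)) _ _)
  exact AddSubgroup.subset_closure ⟨V, W, U, i, j, hi, hj, h, rfl⟩

open scoped Classical in
/-- The extension by zero to all `K`-schemes of a motivic measure. -/
def extendByZero (μ : K0Var K →+* ℝ) (X : Over (Spec (.of K))) : ℝ :=
  if h : IsKVariety K X then μ (K0Var.mk ⟨X, h⟩) else 0

theorem extendByZero_of_isKVariety (μ : K0Var K →+* ℝ) {X : Over (Spec (.of K))}
    (h : IsKVariety K X) : extendByZero μ X = μ (K0Var.mk ⟨X, h⟩) :=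
  dif_pos h

/-- After this only the axioms of `IsPositiveMeasure` matter, so `μ` and point counting can be
treated alike, as functions on unbundled schemes. -/
theorem isPositiveMeasure_extendByZero (μ : K0Var K →+* ℝ)
    (hμ : ∀ V : KVariety K, 0 ≤ μ (K0Var.mk V)) : IsPositiveMeasure (extendByZero μ) where
  nonneg hX := by
    rw [extendByZero_of_isKVariety μ hX]
    exact hμ _
  iso {X Y} hX e := by
    have hY := hX.of_iso e.symm
    rw [extendByZero_of_isKVariety μ hX, extendByZero_of_isKVariety μ hY]
    exact congrArg μ (K0Var.mk_eq_of_iso ((isKVariety K).isoMk e))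
  scissors {V W U} i j hV hW hi hj h := by
    have hU := hV.of_isOpenImmersion j
    rw [extendByZero_of_isKVariety μ hV, extendByZero_of_isKVariety μ hW,
      extendByZero_of_isKVariety μ hU, ← map_add]
    exact congrArg μ (K0Var.mk_eq_add (V := ⟨V, hV⟩) (W := ⟨W, hW⟩) (U := ⟨U, hU⟩)
      (ObjectProperty.homMk i) (ObjectProperty.homMk j) hi hj h)
  unit := by
    rw [extendByZero_of_isKVariety μ isKVariety_unit, ← map_one μ, ← K0Var.mk_unit]
    rfl
  tensor {X Y} hX hY := by
    rw [extendByZero_of_isKVariety μ (isKVariety_tensor hX hY), extendByZero_of_isKVariety μ hX,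
      extendByZero_of_isKVariety μ hY, ← map_mul, ← K0Var.mk_tensor]
    rfl

/-! ### Open subschemes and spectra as schemes over `K`. -/

/-- An open subscheme of a `K`-scheme, as a `K`-scheme. -/
def opensOver (X : Over (Spec (.of K))) (U : X.left.Opens) : Over (Spec (.of K)) :=
  Over.mk (U.ι ≫ X.hom)

/-- The inclusion of an open subscheme, as a morphism of `K`-schemes. -/
def opensOverι (X : Over (Spec (.of K))) (U : X.left.Opens) : opensOver X U ⟶ X :=
  Over.homMk U.ι

instance (X : Over (Spec (.of K))) (U : X.left.Opens) : IsOpenImmersion (opensOverι X U).left :=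
  inferInstanceAs (IsOpenImmersion U.ι)

theorem range_opensOverι (X : Over (Spec (.of K))) (U : X.left.Opens) :
    Set.range (opensOverι X U).left = U :=
  U.range_ι

theorem specOverMap_comp {A B C : Type u} [CommRing A] [Algebra K A] [CommRing B] [Algebra K B]
    [CommRing C] [Algebra K C] (f : A →ₐ[K] B) (g : B →ₐ[K] C) :
    specOverMap g ≫ specOverMap f = specOverMap (g.comp f) :=
  Over.OverMorphism.ext (Spec.map_comp (CommRingCat.ofHom f.toRingHom) _).symm

theorem specOverMap_id (A : Type u) [CommRing A] [Algebra K A] :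
    specOverMap (AlgHom.id K A) = 𝟙 (specOver K A) :=
  Over.OverMorphism.ext (Spec.map_id (.of A))

/-- The isomorphism of spectra over `K` given by an isomorphism of `K`-algebras. -/
def specOverIso {A B : Type u} [CommRing A] [Algebra K A] [CommRing B] [Algebra K B]
    (e : A ≃ₐ[K] B) : specOver K A ≅ specOver K B where
  hom := specOverMap e.symm.toAlgHom
  inv := specOverMap e.toAlgHom
  hom_inv_id := by
    rw [specOverMap_comp, ← specOverMap_id]
    congr 1
    ext x
    simp
  inv_hom_id := by
    rw [specOverMap_comp, ← specOverMap_id]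
    congr 1
    ext x
    simp

/-- The spectrum of a tensor product is the product of the spectra. -/
def specOverTensorIso (A B : Type u) [CommRing A] [Algebra K A] [CommRing B] [Algebra K B] :
    specOver K (A ⊗[K] B) ≅ specOver K A ⊗ specOver K B :=
  Over.isoMk (pullbackSpecIso K A B).symm (by
    refine (Category.assoc _ _ _).symm.trans ((congrArg (· ≫ _)
      (pullbackSpecIso_inv_fst K A B)).trans ?_)
    dsimp [specOver]
    rw [← Spec.map_comp, ← CommRingCat.ofHom_comp])

theorem isClosedImmersion_specOverMap {A B : Type u} [CommRing A] [Algebra K A] [CommRing B]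
    [Algebra K B] (f : A →ₐ[K] B) (hf : Function.Surjective f) :
    IsClosedImmersion (specOverMap f).left :=
  IsClosedImmersion.spec_of_surjective _ hf

/-- A `K`-algebra is geometrically reduced of finite type if it is of finite type and its base
changes to all field extensions are reduced. -/
structure IsGeomReducedOfFiniteType (K A : Type u) [Field K] [CommRing A] [Algebra K A] :
    Prop where
  finiteType : Algebra.FiniteType K A
  isReduced_tensor : ∀ (F : Type u) [Field F] [Algebra K F], IsReduced (A ⊗[K] F)

namespace IsGeomReducedOfFiniteType

variable {A B : Type u} [CommRing A] [Algebra K A] [CommRing B] [Algebra K B]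

theorem isKVariety (h : IsGeomReducedOfFiniteType K A) : IsKVariety K (specOver K A) :=
  have := h.finiteType
  isKVariety_specOver_of_forall A fun F => h.isReduced_tensor F

theorem of_finite [Finite K] [Algebra.FiniteType K A] [IsReduced A] :
    IsGeomReducedOfFiniteType K A :=
  ⟨‹_›, fun F _ _ => isReduced_tensorProduct_of_finite K A F⟩

theorem of_equiv (h : IsGeomReducedOfFiniteType K A) (e : A ≃ₐ[K] B) :
    IsGeomReducedOfFiniteType K B :=
  ⟨h.finiteType.equiv e, fun F _ _ =>
    have := h.isReduced_tensor F
    let e' : B ⊗[K] F ≃ₐ[K] A ⊗[K] F := Algebra.TensorProduct.congr e.symm .refl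
    isReduced_of_injective e' e'.injective⟩

theorem of_subsingleton [Subsingleton A] : IsGeomReducedOfFiniteType K A :=
  ⟨inferInstance, fun F _ _ => by
    have : Subsingleton (A ⊗[K] F) := inferInstance
    infer_instance⟩

theorem prod (hA : IsGeomReducedOfFiniteType K A) (hB : IsGeomReducedOfFiniteType K B) :
    IsGeomReducedOfFiniteType K (A × B) := by
  have := hA.finiteType
  have := hB.finiteType
  refine ⟨inferInstance, fun F _ _ => ?_⟩
  have := hA.isReduced_tensor F
  have := hB.isReduced_tensor F
  let e : (A × B) ⊗[K] F ≃ₐ[K] (F ⊗[K] A) × (F ⊗[K] B) :=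
    (Algebra.TensorProduct.comm K _ _).trans (Algebra.TensorProduct.prodRight K K F A B)
  have h1 : IsReduced (F ⊗[K] A) :=
    isReduced_of_injective _ (Algebra.TensorProduct.comm K F A).injective
  have h2 : IsReduced (F ⊗[K] B) :=
    isReduced_of_injective _ (Algebra.TensorProduct.comm K F B).injective
  exact isReduced_of_injective e e.injective

end IsGeomReducedOfFiniteType

/-! ### Monotonicity and values on affine schemes. -/

namespace IsPositiveMeasure

variable {φ : Over (Spec (.of K)) → ℝ} (hφ : IsPositiveMeasure φ)
include hφ

theorem le_of_isClosedImmersion {X W : Over (Spec (.of K))} (hX : IsKVariety K X)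
    (hW : IsKVariety K W) (i : W ⟶ X) [hi : IsClosedImmersion i.left] : φ W ≤ φ X := by
  let U : X.left.Opens :=
    ⟨(Set.range i.left)ᶜ, i.left.isClosedEmbedding.isClosed_range.isOpen_compl⟩
  have h := hφ.scissors i (opensOverι X U) hX hW hi inferInstance (range_opensOverι X U)
  have := hφ.nonneg (hX.of_isOpenImmersion (opensOverι X U))
  linarith

variable {A B : Type u} [CommRing A] [Algebra K A] [CommRing B] [Algebra K B]

theorem specOver_congr (hA : IsKVariety K (specOver K A))
    (e : A ≃ₐ[K] B) : φ (specOver K A) = φ (specOver K B) :=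
  hφ.iso hA (specOverIso e)

theorem specOver_le_of_surjective (hA : IsKVariety K (specOver K A))
    (hB : IsKVariety K (specOver K B)) (f : A →ₐ[K] B) (hf : Function.Surjective f) :
    φ (specOver K B) ≤ φ (specOver K A) :=
  have := isClosedImmersion_specOverMap f hf
  hφ.le_of_isClosedImmersion hA hB (specOverMap f)

theorem specOver_tensor (hA : IsKVariety K (specOver K A)) (hB : IsKVariety K (specOver K B)) :
    φ (specOver K (A ⊗[K] B)) = φ (specOver K A) * φ (specOver K B) := by
  rw [← hφ.tensor hA hB]
  exact (hφ.iso (isKVariety_tensor hA hB) (specOverTensorIso A B).symm).symm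

theorem specOver_self : φ (specOver K K) = 1 := by
  rw [← hφ.unit]
  refine (hφ.iso isKVariety_unit ?_).symm
  exact Over.isoMk (Iso.refl _) ((Category.id_comp _).trans (Spec.map_id _))

/-- Together `hf` and `hker` say that the image of `Spec B` is the zero locus of `f`, the complement
of `Spec C`. -/
theorem specOver_away (hA : IsKVariety K (specOver K A)) (hB : IsKVariety K (specOver K B))
    (f : A) (g : A →ₐ[K] B) (hg : Function.Surjective g) (hf : g f = 0)
    (hker : RingHom.ker g ≤ (Ideal.span {f}).radical) (C : Type u) [CommRing C] [Algebra K C]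
    [Algebra A C] [IsScalarTower K A C] [IsLocalization.Away f C] :
    φ (specOver K A) = φ (specOver K B) + φ (specOver K C) := by
  refine hφ.scissors (specOverMap g) (specOverMap (IsScalarTower.toAlgHom K A C)) hA hB
    (isClosedImmersion_specOverMap g hg) (IsOpenImmersion.of_isLocalization f) ?_
  refine (PrimeSpectrum.localization_away_comap_range C f).trans ?_
  refine (PrimeSpectrum.basicOpen_eq_zeroLocus_compl f).trans ?_
  refine congrArg _ (Eq.trans ?_ (range_comap_of_surjective _ _ hg).symm)
  refine le_antisymm ?_ ?_
  · rw [← PrimeSpectrum.zeroLocus_span {f}, ← PrimeSpectrum.zeroLocus_radical (Ideal.span {f})]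
    exact PrimeSpectrum.zeroLocus_anti_mono hker
  · exact PrimeSpectrum.zeroLocus_anti_mono (Set.singleton_subset_iff.2 hf)

theorem specOver_prod (hA : IsKVariety K (specOver K A))
    (hAB : IsKVariety K (specOver K (A × B))) :
    φ (specOver K (A × B)) = φ (specOver K A) + φ (specOver K B) := by
  let _ : Algebra (A × B) B := (RingHom.snd A B).toAlgebra
  have : IsScalarTower K (A × B) B := .of_algebraMap_eq fun _ => rfl
  -- The second factor is the open set where the idempotent `(0, 1)` is invertible.
  have : IsLocalization.Away ((0, 1) : A × B) B := by
    apply IsLocalization.away_of_isIdempotentElem_of_mul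
    · ext <;> simp
    · rintro ⟨x, x'⟩ ⟨y, y'⟩
      simp only [RingHom.algebraMap_toAlgebra, RingHom.coe_snd, Prod.mk_mul_mk, Prod.mk.injEq,
        zero_mul, one_mul, true_and]
    · exact fun b => ⟨(0, b), rfl⟩
  refine hφ.specOver_away hAB hA ((0, 1) : A × B) (AlgHom.fst K A B) Prod.fst_surjective rfl
    (fun x hx => Ideal.le_radical ?_) B
  rw [Ideal.mem_span_singleton]
  exact ⟨x, Prod.ext (by simpa using hx) (by simp)⟩

/-- For the zero ring `A × A ≃ A`, so the value equals its own double. -/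
theorem specOver_of_subsingleton [Subsingleton A] (hA : IsKVariety K (specOver K A)) :
    φ (specOver K A) = 0 := by
  have e : (A × A) ≃ₐ[K] A := AlgEquiv.ofBijective (AlgHom.fst K A A)
    ⟨fun _ _ _ => Subsingleton.elim _ _, Prod.fst_surjective⟩
  have h := hφ.specOver_prod (B := A) hA (hA.of_iso (specOverIso e))
  rw [hφ.specOver_congr (hA.of_iso (specOverIso e)) e] at h
  linarith

/-- The two claims are proved together because adding a factor requires the product of the earlier
ones to be a variety. -/
theorem pi_and_specOver_pi {ι : Type u} [Fintype ι] (R : ι → Type u) [∀ i, CommRing (R i)]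
    [∀ i, Algebra K (R i)] (hR : ∀ i, IsGeomReducedOfFiniteType K (R i)) :
    IsGeomReducedOfFiniteType K (∀ i, R i) ∧
      φ (specOver K (∀ i, R i)) = ∑ i, φ (specOver K (R i)) := by
  refine Fintype.induction_empty_option (P := fun α _ => ∀ (R : α → Type u)
    [∀ i, CommRing (R i)] [∀ i, Algebra K (R i)] (_ : ∀ i, IsGeomReducedOfFiniteType K (R i)),
    IsGeomReducedOfFiniteType K (∀ i, R i) ∧
      φ (specOver K (∀ i, R i)) = ∑ i, φ (specOver K (R i))) ?_ ?_ ?_ ι R hR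
  · intro α β _ e ih R _ _ hR
    let _ := Fintype.ofEquiv β e.symm
    let e' := AlgEquiv.piCongrLeft K R e
    obtain ⟨h1, h2⟩ := ih (fun i => R (e i)) (fun i => hR _)
    refine ⟨h1.of_equiv e', ?_⟩
    rw [← hφ.specOver_congr h1.isKVariety e', h2]
    exact e.sum_comp (fun i => φ (specOver K (R i)))
  · intro R _ _ hR
    have h := IsGeomReducedOfFiniteType.of_subsingleton (K := K) (A := ∀ i, R i)
    exact ⟨h, by simpa using hφ.specOver_of_subsingleton h.isKVariety⟩
  · intro α _ ih R _ _ hR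
    obtain ⟨h1, h2⟩ := ih (fun i => R (some i)) (fun i => hR _)
    let e : (R none × ∀ i, R (some i)) ≃ₐ[K] ∀ i, R i :=
      (AlgEquiv.ofRingEquiv (f := RingEquiv.piOptionEquivProd) fun _ => rfl).symm
    have h := (hR none).prod h1
    refine ⟨h.of_equiv e, ?_⟩
    rw [← hφ.specOver_congr h.isKVariety e, hφ.specOver_prod (hR none).isKVariety h.isKVariety, h2,
      Fintype.sum_option]

theorem specOver_fun {ι : Type u} [Finite ι] (hA : IsGeomReducedOfFiniteType K A) :
    φ (specOver K (ι → A)) = Nat.card ι * φ (specOver K A) := by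
  have := Fintype.ofFinite ι
  rw [(hφ.pi_and_specOver_pi (fun _ : ι => A) fun _ => hA).2]
  simp

end IsPositiveMeasure

/-- Algebra homomorphisms to `A` that are pairwise separated by elements of `R` up to units are
jointly surjective. -/
theorem surjective_pi_of_isUnit_sub {A R ι : Type*} [CommRing A] [CommRing R] [Algebra A R]
    [Finite ι] (f : ι → R →ₐ[A] A) (hf : Pairwise fun i j => ∃ r, IsUnit (f i r - f j r)) :
    Function.Surjective (fun (r : R) (i : ι) => f i r) := by
  -- The unit `f i r - f j r` lies in the sum of the two kernels, so they are comaximal and the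
  -- Chinese remainder theorem applies.
  have hcop : Pairwise (Function.onFun IsCoprime fun i => RingHom.ker (f i)) := by
    intro i j hij
    obtain ⟨r, hr⟩ := hf hij
    have hu := (Ideal.eq_top_iff_one (RingHom.ker (f i) ⊔ RingHom.ker (f j))).1
      (Ideal.eq_top_of_isUnit_mem _ (x := algebraMap A R (f i r - f j r)) ?_ (hr.map _))
    · exact Ideal.isCoprime_iff_sup_eq.2 ((Ideal.eq_top_iff_one _).2 hu)
    · have : algebraMap A R (f i r - f j r) =
          (algebraMap A R (f i r) - r) + (r - algebraMap A R (f j r)) := by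
        rw [map_sub]; ring
      rw [this]
      refine Ideal.add_mem _ (Ideal.mem_sup_left ?_) (Ideal.mem_sup_right ?_) <;>
      simp [RingHom.mem_ker]
  intro a
  obtain ⟨r, hr⟩ := Ideal.pi_quotient_surjective hcop fun i =>
    Ideal.Quotient.mk _ (algebraMap A R (a i))
  refine ⟨r, funext fun i => ?_⟩
  have h := Ideal.Quotient.eq.1 (hr i)
  rw [RingHom.mem_ker, map_sub, AlgHom.commutes, sub_eq_zero] at h
  exact h

end

section

/-! ### The field of a positive measure -/

open Polynomial

variable {K : Type u} [Field K]

theorem IsGeomReducedOfFiniteType.self : IsGeomReducedOfFiniteType K K :=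
  ⟨inferInstance, fun F _ _ =>
    isReduced_of_injective _ (Algebra.TensorProduct.lid K F).injective⟩

theorem IsGeomReducedOfFiniteType.polynomial : IsGeomReducedOfFiniteType K K[X] :=
  ⟨inferInstance, fun F _ _ =>
    isReduced_of_injective ((Algebra.TensorProduct.comm K K[X] F).trans (polyEquivTensor K F).symm)
      (AlgEquiv.injective _)⟩

namespace IsPositiveMeasure

variable {φ : Over (Spec (.of K)) → ℝ} (hφ : IsPositiveMeasure φ)
include hφ

/-- Any `N` distinct rational points form a closed subscheme of the line of measure `N`. -/
theorem finite_field : Finite K := by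
  by_contra hK
  rw [not_finite_iff_infinite] at hK
  obtain ⟨N, hN⟩ := exists_nat_gt (φ (specOver K K[X]))
  -- The lift puts the index type in the universe of `K`, as `specOver_fun` needs.
  let a : ULift.{u} (Fin N) → K :=
    fun i => (Fin.valEmbedding.trans (Infinite.natEmbedding K)) i.down
  have ha : Function.Injective a :=
    (Fin.valEmbedding.trans (Infinite.natEmbedding K)).injective.comp ULift.down_injective
  have hsurj := surjective_pi_of_isUnit_sub (fun i => (aeval (a i) : K[X] →ₐ[K] K))
    fun i j hij => ⟨X, by simpa [sub_eq_zero] using ha.ne hij⟩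
  have hself := IsGeomReducedOfFiniteType.self (K := K)
  have hpi := (hφ.pi_and_specOver_pi (fun _ : ULift.{u} (Fin N) => K) fun _ => hself).1
  have := hφ.specOver_le_of_surjective IsGeomReducedOfFiniteType.polynomial.isKVariety
    hpi.isKVariety (AlgHom.pi fun i => aeval (a i)) hsurj
  rw [hφ.specOver_fun hself, hφ.specOver_self] at this
  simp at this
  linarith

variable [Finite K]

/-- Finite extensions of finite fields are Galois, so once `M` embeds in `L` it splits there: `L ⊗
M` is a product of copies of `L` indexed by the embeddings. -/
theorem specOver_mul_eq_card_algHom_mul (L M : Type u) [Field L] [Field M] [Algebra K L]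
    [Algebra K M] [Module.Finite K L] [Module.Finite K M] (σ : M →ₐ[K] L) :
    φ (specOver K M) * φ (specOver K L) = Nat.card (M →ₐ[K] L) * φ (specOver K L) := by
  have hL : IsGeomReducedOfFiniteType K L := .of_finite
  have hM : IsGeomReducedOfFiniteType K M := .of_finite
  let f : (M →ₐ[K] L) → L ⊗[K] M →ₐ[L] L := fun τ =>
    Algebra.TensorProduct.lift (AlgHom.id L L) τ fun _ _ => Commute.all _ _
  have hf : Function.Surjective (AlgHom.pi f) := by
    refine surjective_pi_of_isUnit_sub f fun τ τ' h => ?_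
    obtain ⟨m, hm⟩ := DFunLike.ne_iff.1 h
    exact ⟨1 ⊗ₜ m, by simpa [f, sub_eq_zero] using hm⟩
  have : Finite M := Module.finite_of_finite K
  -- Composing `σ` with the automorphisms of `M` already gives `[M : K]` embeddings; the surjection
  -- onto the product is then bijective by dimension.
  have hcard : Module.finrank K M ≤ Nat.card (M →ₐ[K] L) := by
    rw [← IsGalois.card_aut_eq_finrank K M]
    exact Nat.card_le_card_of_injective (fun τ : M ≃ₐ[K] M => σ.comp τ.toAlgHom) fun τ τ' h =>
      AlgEquiv.ext fun x => σ.injective (DFunLike.congr_fun h x)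
  have hfin : Module.finrank L (L ⊗[K] M) = Module.finrank L ((M →ₐ[K] L) → L) := by
    have := Fintype.ofFinite (M →ₐ[K] L)
    refine le_antisymm ?_ (LinearMap.finrank_le_finrank_of_surjective
      (f := (AlgHom.pi f).toLinearMap) hf)
    rwa [Module.finrank_baseChange, Module.finrank_fintype_fun_eq_card, ← Nat.card_eq_fintype_card]
  have hinj : Function.Injective (AlgHom.pi f) :=
    (LinearMap.injective_iff_surjective_of_finrank_eq_finrank
      (f := (AlgHom.pi f).toLinearMap) hfin).2 hf
  let e : L ⊗[K] M ≃ₐ[K] ((M →ₐ[K] L) → L) :=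
    (AlgEquiv.ofBijective _ ⟨hinj, hf⟩).restrictScalars K
  rw [← hφ.specOver_fun hL, mul_comm, ← hφ.specOver_tensor hL.isKVariety hM.isKVariety]
  have : IsReduced (L ⊗[K] M) := isReduced_tensorProduct_of_finite K L M
  exact hφ.specOver_congr (IsGeomReducedOfFiniteType.of_finite (A := L ⊗[K] M)).isKVariety e

/-- A reduced artinian ring is the product of its residue fields. -/
theorem exists_field_quotient_ne_zero (A : Type u) [CommRing A] [Algebra K A] [Module.Finite K A]
    [IsReduced A] (hA : φ (specOver K A) ≠ 0) :
    ∃ m : MaximalSpectrum A, φ (specOver K (A ⧸ m.asIdeal)) ≠ 0 := by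
  have : IsArtinianRing A := IsArtinianRing.of_finite K A
  have := Fintype.ofFinite (MaximalSpectrum A)
  let e := (IsArtinianRing.equivPi A).restrictScalars K
  have hred (m : MaximalSpectrum A) : IsGeomReducedOfFiniteType K (A ⧸ m.asIdeal) :=
    have := m.isMaximal
    let _ := Ideal.Quotient.field m.asIdeal
    .of_finite
  have hA' : IsGeomReducedOfFiniteType K A := .of_finite
  rw [hφ.specOver_congr hA'.isKVariety e, (hφ.pi_and_specOver_pi _ hred).2] at hA
  obtain ⟨m, -, hm⟩ := Finset.exists_ne_zero_of_sum_ne_zero hA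
  exact ⟨m, hm⟩

theorem exists_field : ∃ (L : Type u) (_ : Field L) (_ : Algebra K L), Module.Finite K L ∧
    ∀ (M : Type u) [Field M] [Algebra K M] [Module.Finite K M],
      φ (specOver K M) = Nat.card (M →ₐ[K] L) := by
  let S : Set ℕ := {n | ∃ (L : Type u) (_ : Field L) (_ : Algebra K L), Module.Finite K L ∧
    φ (specOver K L) ≠ 0 ∧ Module.finrank K L = n}
  have hS : S.Nonempty := ⟨_, K, inferInstance, inferInstance, inferInstance, by
    rw [hφ.specOver_self]; exact one_ne_zero, rfl⟩
  -- If `φ(L) ≠ 0`, the case `M = L` above gives `φ(L) = [L : K]`; a primitive element embeds `Spec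
  -- L` in the line, so the degree is at most `q`.
  have hbdd : BddAbove S := by
    obtain ⟨N, hN⟩ := exists_nat_ge (φ (specOver K K[X]))
    refine ⟨N, ?_⟩
    rintro n ⟨L, _, _, _, hL0, rfl⟩
    have h := mul_right_cancel₀ hL0 (hφ.specOver_mul_eq_card_algHom_mul L L (AlgHom.id K L))
    have hL : IsGeomReducedOfFiniteType K L := .of_finite
    have : Finite L := Module.finite_of_finite K
    obtain ⟨x, hx⟩ := Field.exists_primitive_element K L
    have hsurj : Function.Surjective (aeval x : K[X] →ₐ[K] L) := by
      rw [← AlgHom.range_eq_top, ← Algebra.adjoin_singleton_eq_range_aeval,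
        ← IntermediateField.adjoin_simple_toSubalgebra_of_isAlgebraic
          (Algebra.IsAlgebraic.isAlgebraic x), hx, IntermediateField.top_toSubalgebra]
    have hle := hφ.specOver_le_of_surjective IsGeomReducedOfFiniteType.polynomial.isKVariety
      hL.isKVariety _ hsurj
    rw [h, Nat.card_congr (algEquivEquivAlgHom K L).symm.toEquiv,
      IsGalois.card_aut_eq_finrank] at hle
    exact_mod_cast hle.trans hN
  obtain ⟨L, _, _, _, hL0, hLn⟩ := Nat.sSup_mem hS hbdd
  refine ⟨L, _, _, ‹_›, fun M _ _ _ => ?_⟩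
  by_cases hM : Nonempty (M →ₐ[K] L)
  · exact mul_right_cancel₀ hL0 (hφ.specOver_mul_eq_card_algHom_mul L M hM.some)
  have hempty : IsEmpty (M →ₐ[K] L) := not_nonempty_iff.1 hM
  rw [Nat.card_of_isEmpty, Nat.cast_zero]
  by_contra hM0
  have hL : IsGeomReducedOfFiniteType K L := .of_finite
  have hM : IsGeomReducedOfFiniteType K M := .of_finite
  have hLM : IsReduced (L ⊗[K] M) := isReduced_tensorProduct_of_finite K L M
  -- Some residue field of `L ⊗ M` has nonzero measure and receives both `L` and `M`. Maximality of
  -- `[L : K]` identifies it with `L`, which gives a forbidden embedding of `M`.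
  obtain ⟨m, hm⟩ := hφ.exists_field_quotient_ne_zero (L ⊗[K] M) (by
    rw [hφ.specOver_tensor hL.isKVariety hM.isKVariety]; exact mul_ne_zero hL0 hM0)
  have := m.isMaximal
  let _ := Ideal.Quotient.field m.asIdeal
  let iL : L →ₐ[K] (L ⊗[K] M ⧸ m.asIdeal) :=
    (Ideal.Quotient.mkₐ K m.asIdeal).comp Algebra.TensorProduct.includeLeft
  let iM : M →ₐ[K] (L ⊗[K] M ⧸ m.asIdeal) :=
    (Ideal.Quotient.mkₐ K m.asIdeal).comp Algebra.TensorProduct.includeRight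
  have hle : Module.finrank K (L ⊗[K] M ⧸ m.asIdeal) ≤ Module.finrank K L := by
    rw [hLn]
    exact le_csSup hbdd ⟨_, _, _, inferInstance, hm, rfl⟩
  have hle' := LinearMap.finrank_le_finrank_of_injective (f := iL.toLinearMap) iL.injective
  have hbij : Function.Bijective iL := ⟨iL.injective,
    (LinearMap.injective_iff_surjective_of_finrank_eq_finrank
      (f := iL.toLinearMap) (le_antisymm hle' hle)).1 iL.injective⟩
  exact hempty.elim ((AlgEquiv.ofBijective iL hbij).symm.toAlgHom.comp iM)

end IsPositiveMeasure

end

section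

/-! ### Comparison of positive measures on affine varieties -/

open Polynomial

theorem isLocalization_away_of_surjective {A B C : Type*} [CommRing A] [CommRing B] [CommRing C]
    [Algebra A B] [Algebra A C] [Algebra B C] [IsScalarTower A B C]
    (hsurj : Function.Surjective (algebraMap A B)) (a : A)
    (hker : ∀ x, algebraMap A B x = 0 → a * x = 0) [IsLocalization.Away (algebraMap A B a) C] :
    IsLocalization.Away a C := by
  refine ⟨⟨?_, ?_, ?_⟩⟩
  · rintro ⟨_, n, rfl⟩
    rw [map_pow, IsScalarTower.algebraMap_apply A B C]
    exact (IsLocalization.Away.algebraMap_isUnit (algebraMap A B a)).pow n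
  · intro z
    obtain ⟨n, b, hb⟩ := IsLocalization.Away.surj (algebraMap A B a) z
    obtain ⟨x, rfl⟩ := hsurj b
    refine ⟨⟨x, ⟨_, n, rfl⟩⟩, ?_⟩
    simpa [IsScalarTower.algebraMap_apply A B C] using hb
  · intro x y hxy
    rw [IsScalarTower.algebraMap_apply A B C, IsScalarTower.algebraMap_apply A B C] at hxy
    obtain ⟨⟨_, n, rfl⟩, hc⟩ :=
      (IsLocalization.eq_iff_exists (.powers (algebraMap A B a)) C).1 hxy
    refine ⟨⟨_, n + 1, rfl⟩, ?_⟩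
    have := hker (a ^ n * (x - y)) (by
      simpa [mul_sub, sub_eq_zero] using hc)
    linear_combination this

variable {K : Type u} [Field K] [Finite K]

namespace IsPositiveMeasure

section

variable {φ : Over (Spec (.of K)) → ℝ} (hφ : IsPositiveMeasure φ)
include hφ

/-- The `f i` are sections of the line over `Spec C`, disjoint because their differences are units.
Their union is closed, so `N * φ(C) ≤ φ(C) * q` with `q < N`. -/
theorem specOver_eq_zero_of_isUnit_sub (C : Type u) [CommRing C] [Algebra K C]
    [Algebra.FiniteType K C] [IsReduced C] {N : ℕ} (hN : φ (specOver K K[X]) < N)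
    (f : Fin N → C) (hf : Pairwise fun i j => IsUnit (f i - f j)) : φ (specOver K C) = 0 := by
  have hC : IsGeomReducedOfFiniteType K C := .of_finite
  have : Algebra.FiniteType K (C ⊗[K] K[X]) := .trans (S := C) ‹_› inferInstance
  have hCX : IsGeomReducedOfFiniteType K C[X] :=
    have : IsReduced (C ⊗[K] K[X]) := isReduced_tensorProduct_of_finite K C K[X]
    IsGeomReducedOfFiniteType.of_equiv (A := C ⊗[K] K[X]) .of_finite (polyEquivTensor K C).symm
  have hpi := (hφ.pi_and_specOver_pi (fun _ : ULift.{u} (Fin N) => C) fun _ => hC).1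
  have hsurj := surjective_pi_of_isUnit_sub
    (fun i : ULift.{u} (Fin N) => (aeval (f i.down) : C[X] →ₐ[C] C))
    fun i j hij => ⟨X, by simpa using hf (ULift.down_injective.ne hij)⟩
  have hle := hφ.specOver_le_of_surjective hCX.isKVariety hpi.isKVariety
    ((AlgHom.pi fun i : ULift.{u} (Fin N) => (aeval (f i.down) : C[X] →ₐ[C] C)).restrictScalars K)
    hsurj
  rw [hφ.specOver_fun hC, hφ.specOver_congr hCX.isKVariety (polyEquivTensor K C),
    hφ.specOver_tensor hC.isKVariety IsGeomReducedOfFiniteType.polynomial.isKVariety] at hle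
  simp only [Nat.card_eq_fintype_card, Fintype.card_ulift, Fintype.card_fin] at hle
  have := hφ.nonneg hC.isKVariety
  nlinarith

theorem specOver_eq_quotient_add_away (A : Type u) [CommRing A] [Algebra K A]
    [Algebra.FiniteType K A] [IsReduced A] (a : A) (C : Type u) [CommRing C] [Algebra K C]
    [Algebra A C] [IsScalarTower K A C] [IsLocalization.Away a C] :
    φ (specOver K A) = φ (specOver K (A ⧸ (Ideal.span {a}).radical)) + φ (specOver K C) := by
  have : IsReduced (A ⧸ (Ideal.span {a}).radical) :=
    (Ideal.isRadical_iff_quotient_reduced _).1 (Ideal.radical_isRadical _)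
  refine hφ.specOver_away IsGeomReducedOfFiniteType.of_finite.isKVariety
    IsGeomReducedOfFiniteType.of_finite.isKVariety a (Ideal.Quotient.mkₐ K _)
    (Ideal.Quotient.mkₐ_surjective K _) ?_ (le_of_eq (Ideal.Quotient.mkₐ_ker K _)) C
  exact Ideal.Quotient.eq_zero_iff_mem.2 (Ideal.le_radical (Ideal.mem_span_singleton_self a))

end

variable {φ ψ : Over (Spec (.of K)) → ℝ} (hφ : IsPositiveMeasure φ) (hψ : IsPositiveMeasure ψ)
  (hfield : ∀ (M : Type u) [Field M] [Algebra K M] [Module.Finite K M],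
    φ (specOver K M) = ψ (specOver K M))
include hφ hψ hfield

/-- The inductive step of the noetherian induction; `IH` covers the proper closed subsets. -/
theorem specOver_eq_of_quotients (A : Type u) [CommRing A] [Algebra K A] [Algebra.FiniteType K A]
    [IsReduced A] (IH : ∀ I : Ideal A, I ≠ ⊥ → I.IsRadical →
      φ (specOver K (A ⧸ I)) = ψ (specOver K (A ⧸ I))) : φ (specOver K A) = ψ (specOver K A) := by
  have hrad (a : A) (ha : a ≠ 0) := IH _
    (ne_bot_of_le_ne_bot (by simpa using ha) (Ideal.le_radical (I := Ideal.span {a})))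
    (Ideal.radical_isRadical _)
  have hA : IsGeomReducedOfFiniteType K A := .of_finite
  rcases subsingleton_or_nontrivial A with h | h
  · rw [hφ.specOver_of_subsingleton hA.isKVariety, hψ.specOver_of_subsingleton hA.isKVariety]
  by_cases hdom : NoZeroDivisors A
  · have : IsDomain A := NoZeroDivisors.to_isDomain A
    rcases finite_or_infinite A with hfin | hinf
    · let _ := (Finite.isField_of_domain A).toField
      have : Module.Finite K A := .of_finite
      exact hfield A
    · obtain ⟨N, hN⟩ := exists_nat_gt (max (φ (specOver K K[X])) (ψ (specOver K K[X])))
      let f : Fin N → A := Fin.valEmbedding.trans (Infinite.natEmbedding A)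
      have hf : Function.Injective f := (Fin.valEmbedding.trans (Infinite.natEmbedding A)).injective
      -- Inverting `g` makes all differences units, so both measures vanish on `D(g)`.
      let g : A := ∏ i : Fin N, ∏ j : Fin N, if i = j then 1 else f i - f j
      have hg : g ≠ 0 := by
        refine Finset.prod_ne_zero_iff.2 fun i _ => Finset.prod_ne_zero_iff.2 fun j _ => ?_
        split_ifs with hij
        · exact one_ne_zero
        · exact sub_ne_zero.2 (hf.ne hij)
      have hunit : Pairwise fun i j => IsUnit
          (algebraMap A (Localization.Away g) (f i) -
            algebraMap A (Localization.Away g) (f j)) := by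
        intro i j hij
        rw [← map_sub]
        refine isUnit_of_dvd_unit (map_dvd _ ?_) (IsLocalization.Away.algebraMap_isUnit g)
        refine Dvd.dvd.trans ?_ (Finset.dvd_prod_of_mem _ (Finset.mem_univ i))
        refine Dvd.dvd.trans ?_ (Finset.dvd_prod_of_mem _ (Finset.mem_univ j))
        rw [if_neg hij]
      have : Algebra.FiniteType K (Localization.Away g) :=
        have := IsLocalization.finiteType_of_monoid_fg (.powers g) (Localization.Away g)
        .trans (S := A) ‹_› ‹_›
      rw [hφ.specOver_eq_quotient_add_away A g (Localization.Away g),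
        hψ.specOver_eq_quotient_add_away A g (Localization.Away g), hrad g hg,
        hφ.specOver_eq_zero_of_isUnit_sub _ ((le_max_left _ _).trans_lt hN) _ hunit,
        hψ.specOver_eq_zero_of_isUnit_sub _ ((le_max_right _ _).trans_lt hN) _ hunit]
  · obtain ⟨a, b, hab, ha, hb⟩ : ∃ a b : A, a * b = 0 ∧ a ≠ 0 ∧ b ≠ 0 := by
      by_contra! H
      exact hdom ⟨fun {a b} hab => or_iff_not_imp_left.2 fun ha => H a b hab ha⟩
    -- The annihilator of `a` cuts out a proper closed subset, as `b ∈ I`, that still contains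
    -- `D(a)`. Thus `φ(D(a))` can be computed inside `A ⧸ I`, where `IH` applies.
    let I : Ideal A := (⊥ : Ideal A).colon {a}
    have hI (x : A) : x ∈ I ↔ a * x = 0 := by
      simp [I, Submodule.mem_colon_singleton, mul_comm]
    have hIrad : I.IsRadical := by
      rintro x ⟨n, hn⟩
      rw [hI] at hn ⊢
      refine IsReduced.eq_zero _ ⟨n + 1, ?_⟩
      linear_combination (a ^ n * x) * hn
    have hIbot : I ≠ ⊥ := fun h => hb (by rw [← Ideal.mem_bot, ← h, hI, hab])
    have : IsReduced (A ⧸ I) := (Ideal.isRadical_iff_quotient_reduced _).1 hIrad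
    let a' : A ⧸ I := algebraMap A (A ⧸ I) a
    let C := Localization.Away a'
    have hloc : IsLocalization.Away a C :=
      isLocalization_away_of_surjective Ideal.Quotient.mk_surjective a fun x hx =>
        (hI x).1 (Ideal.Quotient.eq_zero_iff_mem.1 hx)
    have hred : IsReduced ((A ⧸ I) ⧸ (Ideal.span {a'}).radical) :=
      (Ideal.isRadical_iff_quotient_reduced _).1 (Ideal.radical_isRadical _)
    -- `IH` speaks of quotients of `A` only, so the iterated quotient is rewritten as one.
    let q : A →ₐ[K] ((A ⧸ I) ⧸ (Ideal.span {a'}).radical) :=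
      (Ideal.Quotient.mkₐ K _).comp (Ideal.Quotient.mkₐ K I)
    have hq : Function.Surjective q :=
      (Ideal.Quotient.mkₐ_surjective K _).comp (Ideal.Quotient.mkₐ_surjective K I)
    have hle : I ≤ RingHom.ker q := fun x hx => by
      have : Ideal.Quotient.mk I x = 0 := Ideal.Quotient.eq_zero_iff_mem.2 hx
      simp [q, RingHom.mem_ker, this]
    have e := Ideal.quotientKerAlgEquivOfSurjective hq
    have hqred : IsReduced (A ⧸ RingHom.ker q) := isReduced_of_injective e e.injective
    have h1 := IH (RingHom.ker q) (ne_bot_of_le_ne_bot hIbot hle)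
      ((Ideal.isRadical_iff_quotient_reduced _).2 hqred)
    have hqG : IsGeomReducedOfFiniteType K (A ⧸ RingHom.ker q) := .of_finite
    rw [hφ.specOver_congr hqG.isKVariety e, hψ.specOver_congr hqG.isKVariety e] at h1
    have h2 := hφ.specOver_eq_quotient_add_away (A ⧸ I) a' C
    have h3 := hψ.specOver_eq_quotient_add_away (A ⧸ I) a' C
    have h4 := hφ.specOver_eq_quotient_add_away A a C
    have h5 := hψ.specOver_eq_quotient_add_away A a C
    have h6 := IH I hIbot hIrad
    have h7 := hrad a ha
    linarith

theorem specOver_eq (A : Type u) [CommRing A] [Algebra K A] [Algebra.FiniteType K A]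
    [IsReduced A] : φ (specOver K A) = ψ (specOver K A) := by
  have : IsNoetherianRing A := Algebra.FiniteType.isNoetherianRing K A
  -- Quantifying over all surjections from `A`, not just `A ⧸ I`, avoids iterated quotients in the
  -- induction.
  suffices H : ∀ (I : Ideal A) (B : Type u) [CommRing B] [Algebra K B] [IsReduced B]
      (f : A →ₐ[K] B), Function.Surjective f → RingHom.ker f = I →
      φ (specOver K B) = ψ (specOver K B) from
    H _ A (AlgHom.id K A) Function.surjective_id rfl
  intro I
  induction I using WellFoundedGT.induction with
  | ind I IH =>
    intro B _ _ _ f hf hI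
    have : Algebra.FiniteType K B := .of_surjective f hf
    refine specOver_eq_of_quotients hφ hψ hfield B fun J hJ hJrad => ?_
    have : IsReduced (B ⧸ J) := (Ideal.isRadical_iff_quotient_reduced _).1 hJrad
    let q : A →ₐ[K] B ⧸ J := (Ideal.Quotient.mkₐ K J).comp f
    refine IH (RingHom.ker q) ?_ (B ⧸ J) q ((Ideal.Quotient.mkₐ_surjective K J).comp hf) rfl
    rw [← hI]
    refine lt_of_le_of_ne (fun x hx => ?_) fun h => hJ ?_
    · have hx' : f x = 0 := hx
      simp [q, hx', RingHom.mem_ker]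
    · refine (Submodule.eq_bot_iff _).2 fun y hy => ?_
      obtain ⟨x, rfl⟩ := hf y
      have : x ∈ RingHom.ker q := Ideal.Quotient.eq_zero_iff_mem.2 hy
      rwa [← h] at this

end IsPositiveMeasure

end

section

/-! ### Comparison of positive measures on varieties -/

instance isReduced_subscheme_vanishingIdeal {X : Scheme.{u}} (Z : TopologicalSpace.Closeds X) :
    AlgebraicGeometry.IsReduced (Scheme.IdealSheafData.vanishingIdeal Z).subscheme := by
  have hred (U : X.affineOpens) : AlgebraicGeometry.IsReduced
      ((Scheme.IdealSheafData.vanishingIdeal Z).subschemeCover.openCover.X U) := by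
    refine (affine_isReduced_iff _).2 ?_
    refine (Ideal.isRadical_iff_quotient_reduced _).1 ?_
    rw [Scheme.IdealSheafData.vanishingIdeal_ideal]
    exact PrimeSpectrum.isRadical_vanishingIdeal _
  exact @IsReduced.of_openCover _
    (Scheme.IdealSheafData.vanishingIdeal Z).subschemeCover.openCover hred

variable {K : Type u} [Field K]

theorem IsKVariety.isReduced {X : Over (Spec (.of K))} (hX : IsKVariety K X) :
    AlgebraicGeometry.IsReduced X.left :=
  hX.geometricallyReduced.geometrically_isReduced (𝟙 _) (𝟙 _) X.hom
    (IsPullback.of_horiz_isIso ⟨by simp⟩)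

theorem IsKVariety.exists_iso_specOver {X : Over (Spec (.of K))} (hX : IsKVariety K X)
    [IsAffine X.left] : ∃ (A : Type u) (_ : CommRing A) (_ : Algebra K A), Algebra.FiniteType K A ∧
      IsReduced A ∧ Nonempty (X ≅ specOver K A) := by
  obtain ⟨f, hf⟩ := Spec.map_surjective (X.left.isoSpec.inv ≫ X.hom)
  let _ : Algebra K Γ(X.left, ⊤) := f.hom.toAlgebra
  have := hX.isReduced
  have := hX.locallyOfFiniteType
  refine ⟨Γ(X.left, ⊤), inferInstance, inferInstance, ?_, inferInstance,
    ⟨Over.isoMk X.left.isoSpec ?_⟩⟩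
  · have : LocallyOfFiniteType (Spec.map f) := by rw [hf]; infer_instance
    rw [HasRingHomProperty.Spec_iff (P := @LocallyOfFiniteType)] at this
    exact this
  · exact (Iso.eq_inv_comp _).1 hf

namespace IsPositiveMeasure

variable [Finite K] {φ ψ : Over (Spec (.of K)) → ℝ} (hφ : IsPositiveMeasure φ)
  (hψ : IsPositiveMeasure ψ)
include hφ hψ

/-- Removing `U 0` leaves a closed set, taken with its reduced structure, that the other `n` affine
opens cover. -/
theorem eq_of_affine_cover (haff : ∀ X, IsKVariety K X → IsAffine X.left → φ X = ψ X) (n : ℕ) :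
    ∀ {X : Over (Spec (.of K))} (_ : IsKVariety K X) (U : Fin n → X.left.Opens)
      (_ : ∀ i, IsAffineOpen (U i)) (_ : ∀ x, ∃ i, x ∈ U i), φ X = ψ X := by
  induction n with
  | zero =>
    intro X hX U _ hcov
    have : IsEmpty X.left := ⟨fun x => (hcov x).elim fun i _ => i.elim0⟩
    exact haff X hX inferInstance
  | succ n ih =>
    intro X hX U haffU hcov
    let Z : TopologicalSpace.Closeds X.left := ⟨(U 0 : Set X.left)ᶜ, (U 0).isOpen.isClosed_compl⟩
    let I := Scheme.IdealSheafData.vanishingIdeal Z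
    let W : Over (Spec (.of K)) := Over.mk (I.subschemeι ≫ X.hom)
    let i : W ⟶ X := Over.homMk I.subschemeι
    have hi : IsClosedImmersion i.left := inferInstanceAs (IsClosedImmersion I.subschemeι)
    have : AlgebraicGeometry.IsReduced W.left := isReduced_subscheme_vanishingIdeal Z
    have hW : IsKVariety K W := hX.of_isClosedImmersion i
    have hrange : Set.range i.left = (U 0 : Set X.left)ᶜ := by
      refine I.range_subschemeι.trans ?_
      simp [I, Z]
    have hrange' : Set.range (opensOverι X (U 0)).left = (Set.range i.left)ᶜ := by
      rw [hrange, compl_compl, range_opensOverι]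
    have h0 := haff (opensOver X (U 0)) (hX.of_isOpenImmersion (opensOverι X (U 0))) (haffU 0)
    have h1 : φ W = ψ W := by
      refine ih hW (fun j => i.left ⁻¹ᵁ U j.succ) (fun j => (haffU _).preimage _) fun x => ?_
      obtain ⟨j, hj⟩ := hcov (i.left x)
      induction j using Fin.cases with
      | zero =>
        have : i.left x ∈ Set.range i.left := ⟨x, rfl⟩
        rw [hrange] at this
        exact absurd hj this
      | succ j => exact ⟨j, hj⟩
    rw [hφ.scissors i (opensOverι X (U 0)) hX hW hi inferInstance hrange',
      hψ.scissors i (opensOverι X (U 0)) hX hW hi inferInstance hrange', h0, h1]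

theorem eq_of_forall_field
    (hfield : ∀ (M : Type u) [Field M] [Algebra K M] [Module.Finite K M],
      φ (specOver K M) = ψ (specOver K M)) {X : Over (Spec (.of K))} (hX : IsKVariety K X) :
    φ X = ψ X := by
  have := hX.quasiCompact
  have : CompactSpace X.left := QuasiCompact.compactSpace_of_compactSpace X.hom
  let 𝒰 := X.left.affineCover.finiteSubcover
  have := Fintype.ofFinite 𝒰.I₀
  let e := (Fintype.equivFin 𝒰.I₀).symm
  refine eq_of_affine_cover hφ hψ (fun X hX _ => ?_) _ hX (fun i => (𝒰.f (e i)).opensRange)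
    (fun i => ?_) fun x => ?_
  · obtain ⟨A, _, _, _, _, ⟨e⟩⟩ := hX.exists_iso_specOver
    rw [hφ.iso hX e, hψ.iso hX e]
    exact specOver_eq hφ hψ hfield A
  · exact isAffineOpen_opensRange _
  · obtain ⟨i, y, hy⟩ := 𝒰.exists_eq x
    exact ⟨e.symm i, by rw [e.apply_symm_apply]; exact ⟨y, hy⟩⟩

end IsPositiveMeasure

end

section

/-! ### Counting measures -/

variable {K : Type u} [Field K]

/-- Morphisms of affine schemes over `K` are homomorphisms of `K`-algebras. -/
def specOverHomEquiv (A B : Type u) [CommRing A] [Algebra K A] [CommRing B] [Algebra K B] :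
    (A →ₐ[K] B) ≃ (specOver K B ⟶ specOver K A) :=
  Equiv.ofBijective specOverMap (by
    constructor
    · intro f g h
      have h' := Spec.map_injective (congrArg (·.left) h)
      exact AlgHom.ext fun x => congr($(h') x)
    · intro f
      obtain ⟨g, hg⟩ := Spec.map_surjective f.left
      have hw : Spec.map (CommRingCat.ofHom (algebraMap K A) ≫ g) =
          Spec.map (CommRingCat.ofHom (algebraMap K B)) := by
        rw [Spec.map_comp, hg]
        exact Over.w f
      have h' := Spec.map_injective hw
      exact ⟨⟨g.hom, fun x => congr($(h') x)⟩, Over.OverMorphism.ext hg⟩)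

theorem finite_algHom_of_finiteType (A L : Type*) [CommRing A] [Algebra K A]
    [Algebra.FiniteType K A] [CommRing L] [Algebra K L] [Finite L] : Finite (A →ₐ[K] L) := by
  obtain ⟨s, hs⟩ := Algebra.FiniteType.out (R := K) (A := A)
  refine Finite.of_injective (fun (f : A →ₐ[K] L) (x : s) => f x) fun f g h => ?_
  exact AlgHom.ext_of_adjoin_eq_top hs fun x hx => congrFun h ⟨x, hx⟩

/-! ### Lifting and counting `L`-points. -/

section

variable (L : Type u) [Field L] [Algebra K L]

instance : Unique (specOver K L).left :=
  inferInstanceAs (Unique (PrimeSpectrum L))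

instance : AlgebraicGeometry.IsReduced (specOver K L).left :=
  inferInstanceAs (AlgebraicGeometry.IsReduced (Spec (.of L)))

variable {L}

theorem exists_comp_eq_of_mem_range_of_isOpenImmersion {X U : Over (Spec (.of K))} (j : U ⟶ X)
    [IsOpenImmersion j.left] (f : specOver K L ⟶ X) (h : f.left default ∈ Set.range j.left) :
    ∃ g : specOver K L ⟶ U, g ≫ j = f := by
  have hf : Set.range f.left ⊆ Set.range j.left := by
    rintro _ ⟨x, rfl⟩
    rwa [Unique.eq_default x]
  refine ⟨Over.homMk (IsOpenImmersion.lift j.left f.left hf) ?_, ?_⟩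
  · rw [← Over.w j, IsOpenImmersion.lift_fac_assoc, Over.w f]
  · exact Over.OverMorphism.ext (IsOpenImmersion.lift_fac _ _ _)

theorem exists_comp_eq_of_mem_range_of_isClosedImmersion {X W : Over (Spec (.of K))} (i : W ⟶ X)
    [IsClosedImmersion i.left] (f : specOver K L ⟶ X) (h : f.left default ∈ Set.range i.left) :
    ∃ g : specOver K L ⟶ W, g ≫ i = f := by
  -- The pullback of `i` along `f` is a surjective closed immersion into the reduced scheme `Spec
  -- L`, hence an isomorphism.
  have hsurj : Surjective (Limits.pullback.fst f.left i.left) := by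
    refine ⟨fun x => ?_⟩
    change x ∈ Set.range _
    rw [Scheme.Pullback.range_fst, Unique.eq_default x]
    exact h
  have := isIso_of_isClosedImmersion_of_surjective (Limits.pullback.fst f.left i.left)
  have hg : (inv (Limits.pullback.fst f.left i.left) ≫ Limits.pullback.snd f.left i.left) ≫ i.left
      = f.left := by
    rw [Category.assoc, ← Limits.pullback.condition, IsIso.inv_hom_id_assoc]
  refine ⟨Over.homMk (inv (Limits.pullback.fst f.left i.left) ≫ Limits.pullback.snd _ _) ?_, ?_⟩
  · rw [← Over.w i, ← Category.assoc, hg, Over.w f]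
  · exact Over.OverMorphism.ext hg

theorem finite_hom_of_isKVariety [Finite L] {X : Over (Spec (.of K))} (hX : IsKVariety K X) :
    Finite (specOver K L ⟶ X) := by
  have := hX.quasiCompact
  have : CompactSpace X.left := QuasiCompact.compactSpace_of_compactSpace X.hom
  let 𝒰 := X.left.affineCover.finiteSubcover
  have hfin (i : 𝒰.I₀) : Finite (specOver K L ⟶ opensOver X (𝒰.f i).opensRange) := by
    have : IsAffine (opensOver X (𝒰.f i).opensRange).left := isAffineOpen_opensRange (𝒰.f i)
    obtain ⟨A, _, _, _, _, ⟨e⟩⟩ :=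
      (hX.of_isOpenImmersion (opensOverι X (𝒰.f i).opensRange)).exists_iso_specOver
    have := finite_algHom_of_finiteType (K := K) A L
    exact Finite.of_equiv _ ((specOverHomEquiv A L).trans (e.symm.homToEquiv))
  refine Finite.of_surjective (fun p : Σ i, (specOver K L ⟶ opensOver X (𝒰.f i).opensRange) =>
    p.2 ≫ opensOverι X _) fun f => ?_
  obtain ⟨i, y, hy⟩ := 𝒰.exists_eq (f.left default)
  obtain ⟨g, hg⟩ := exists_comp_eq_of_mem_range_of_isOpenImmersion
    (opensOverι X (𝒰.f i).opensRange) f (by rw [range_opensOverι]; exact ⟨y, hy⟩)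
  exact ⟨⟨i, g⟩, hg⟩

theorem card_hom_eq_add [Finite L] {V W U : Over (Spec (.of K))} (i : W ⟶ V) (j : U ⟶ V)
    (hV : IsKVariety K V) (hW : IsKVariety K W) [IsClosedImmersion i.left]
    [IsOpenImmersion j.left] (h : Set.range j.left = (Set.range i.left)ᶜ) :
    Nat.card (specOver K L ⟶ V) = Nat.card (specOver K L ⟶ W) + Nat.card (specOver K L ⟶ U) := by
  have := finite_hom_of_isKVariety (L := L) hW
  have := finite_hom_of_isKVariety (L := L) (hV.of_isOpenImmersion j)
  have : Mono i := (Over.forget _).mono_of_mono_map (inferInstanceAs (Mono i.left))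
  have : Mono j := (Over.forget _).mono_of_mono_map (inferInstanceAs (Mono j.left))
  rw [← Nat.card_sum]
  refine (Nat.card_congr (Equiv.ofBijective (Sum.elim (· ≫ i) (· ≫ j)) ⟨?_, fun f => ?_⟩)).symm
  · refine Function.Injective.sumElim (fun _ _ => (cancel_mono i).1)
      (fun _ _ => (cancel_mono j).1) fun g g' hgg' => ?_
    have h1 : (g' ≫ j).left default ∈ Set.range j.left := ⟨g'.left default, rfl⟩
    rw [h, ← hgg'] at h1
    exact h1 ⟨g.left default, rfl⟩
  · by_cases hf : f.left default ∈ Set.range i.left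
    · obtain ⟨g, hg⟩ := exists_comp_eq_of_mem_range_of_isClosedImmersion i f hf
      exact ⟨.inl g, hg⟩
    · obtain ⟨g, hg⟩ := exists_comp_eq_of_mem_range_of_isOpenImmersion j f (h ▸ hf)
      exact ⟨.inr g, hg⟩

variable (L) in
theorem isPositiveMeasure_card_hom [Finite L] :
    IsPositiveMeasure fun X : Over (Spec (.of K)) => (Nat.card (specOver K L ⟶ X) : ℝ) where
  nonneg _ := Nat.cast_nonneg _
  iso _ e := by rw [Nat.card_congr e.homToEquiv]
  scissors i j hV hW _ _ h := by
    rw [card_hom_eq_add i j hV hW h, Nat.cast_add]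
  unit := by
    have : Unique (specOver K L ⟶ 𝟙_ _) :=
      ⟨⟨SemiCartesianMonoidalCategory.toUnit _⟩,
        fun _ => SemiCartesianMonoidalCategory.toUnit_unique _ _⟩
    rw [Nat.card_unique, Nat.cast_one]
  tensor {X Y} _ _ := by
    rw [← Nat.cast_mul, ← Nat.card_prod]
    exact congrArg _ (Nat.card_congr CartesianMonoidalCategory.homEquivToProd)

end

end

end MotivicMeasure

end

theorem theorem1 (K : Type u) [Field K] (μ : MotivicMeasure.K0Var K →+* ℝ)
    (hμ : ∀ V : MotivicMeasure.KVariety K, 0 ≤ μ (MotivicMeasure.K0Var.mk V)) :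
    ∃ (L : Type u) (_ : Field L) (_ : Algebra K L), Finite L ∧
      ∀ V : MotivicMeasure.KVariety K,
        Finite (MotivicMeasure.Points V L) ∧
          μ (MotivicMeasure.K0Var.mk V) = Nat.card (MotivicMeasure.Points V L) := by
  have hφ := MotivicMeasure.isPositiveMeasure_extendByZero μ hμ
  have := hφ.finite_field
  obtain ⟨L, _, _, _, hL⟩ := hφ.exists_field
  have : Finite L := Module.finite_of_finite K
  refine ⟨L, inferInstance, inferInstance, this, fun V =>
    ⟨MotivicMeasure.finite_hom_of_isKVariety V.property, ?_⟩⟩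
  rw [← MotivicMeasure.extendByZero_of_isKVariety μ V.property]
  -- By the choice of `L`, both measures take the value `#Hom_K(M, L)` on `Spec M`.
  refine hφ.eq_of_forall_field (MotivicMeasure.isPositiveMeasure_card_hom L) (fun M _ _ _ => ?_)
    V.property
  rw [hL M, Nat.card_congr (MotivicMeasure.specOverHomEquiv M L)]
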